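/- For positive integers $k_1,\dots,k_n$ with $k_n\ge 2$ let $$\zeta^{\star}(k_1,\dots,k_n)=\sum_{1\le m_1\le\cdots\le m_n}\frac{1}{m_1^{k_1}\cdots m_n^{k_n}}$$ (sum over all integer tuples $(m_1,\dots,m_n)$ as indicated) be the multiple zeta-star value, and let $\zeta$ be the Riemann zeta function. Then for every integer $s\ge 1$ the multiple series on the right-hand side below converge, and $$(2s-1)\,\zeta(2s)=\zeta^{\star}(\underbrace{2,\dots,2}_{s})+\sum_{i=0}^{s-2}\zeta^{\star}(1,\underbrace{2,\dots,2}_{i},3,\underbrace{2,\dots,2}_{s-2-i}),$$ where the sum over $i$ is empty for $s=1$. -/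

import Mathlib

/-- The term `1 / (m₁ ^ k₁ ⋯ mₙ ^ kₙ)` of the multiple zeta-star series with index
`k = [k₁, …, kₙ]`, as a function of the tuple of positive integers `m₁ ≤ ⋯ ≤ mₙ`. -/
noncomputable def mzsvTerm (k : List ℕ) (m : {m : Fin k.length → ℕ+ // Monotone m}) : ℝ :=
  1 / ∏ j : Fin k.length, ((m.1 j : ℕ) : ℝ) ^ k.get j

/-- The multiple zeta-star value `ζ⋆(k₁, …, kₙ) = ∑_{0 < m₁ ≤ ⋯ ≤ mₙ} 1 / (m₁ ^ k₁ ⋯ mₙ ^ kₙ)`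
(so that the last exponent belongs to the largest summation variable). -/
noncomputable def zetaStar (k : List ℕ) : ℝ :=
  ∑' m : {m : Fin k.length → ℕ+ // Monotone m}, mzsvTerm k m

/-- The index `(2, …, 2)` with `s` entries. -/
def indexTwos (s : ℕ) : List ℕ :=
  List.replicate s 2

/-- The index `(1, 2, …, 2, 3, 2, …, 2)` with `i` twos between `1` and `3` and `j` twos after `3`. -/
def indexOneThree (i j : ℕ) : List ℕ :=
  [1] ++ List.replicate i 2 ++ [3] ++ List.replicate j 2

open scoped ENNReal

/-! All identities are proved in `ℝ≥0∞`, where sums can be interchanged freely. To a chain a ≤ m₁ ≤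
⋯ ≤ b attach the factor 1/(b - a), as in `gapSum`. Two moves act on such sums.

Shift (`gapSum_add_starSum`): 1/(b(b-a)) + 1/(ab) = 1/(a(b-a)) moves one power from b to a; the term
1/(ab) gives a zeta-star value, up to its diagonal a = b, which is a zeta value.

Rotation (`gapSum_concat_one`, `gapSum_nil_one`): once b has exponent 1, summing over b telescopes
and replaces b by a new smallest variable p, again at the cost of a zeta value.

For s = r + 2, run through all s - 1 rotations of (3,2,…,2). Moving a final 2 to the front gives one
value ζ⋆(1,…,3,…,2) and 2ζ(2s); moving the final 3 gives ζ⋆(1,2,…,2,3), ζ⋆(2,…,2) and 3ζ(2s). The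
gap sums form a cycle and are finite (`gapSum_ne_top`), so they cancel, leaving 2(s-2) + 3 = 2s - 1
copies of ζ(2s). -/

/-- The reciprocal of a positive integer, as an extended nonnegative real. -/
noncomputable def recip (m : ℕ+) : ℝ≥0∞ := ((m : ℕ) : ℝ≥0∞)⁻¹

/-- `1 / (b - a)` if `a < b`, and `0` otherwise. -/
noncomputable def recipGap (a b : ℕ+) : ℝ≥0∞ :=
  if a < b then (((b : ℕ) - (a : ℕ) : ℕ) : ℝ≥0∞)⁻¹ else 0

/-- `∑ 1 / (m₁ ^ k₁ ⋯ mₙ ^ kₙ)` over `a ≤ m₁ ≤ ⋯ ≤ mₙ ≤ b`. -/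
noncomputable def chainSum : List ℕ → ℕ+ → ℕ+ → ℝ≥0∞
  | [], a, b => if a ≤ b then 1 else 0
  | k :: ks, a, b => ∑' m, if a ≤ m then recip m ^ k * chainSum ks m b else 0

/-- `∑ 1 / (m₁ ^ k₁ ⋯ mₙ ^ kₙ)` over `a ≤ m₁ ≤ ⋯ ≤ mₙ`. -/
noncomputable def starSum : List ℕ → ℕ+ → ℝ≥0∞
  | [], _ => 1
  | k :: ks, a => ∑' m, if a ≤ m then recip m ^ k * starSum ks m else 0

/-- The zeta value `∑ 1 / a ^ n` in the extended nonnegative reals. -/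
noncomputable def ezeta (n : ℕ) : ℝ≥0∞ := ∑' a, recip a ^ n

/-- `∑ 1 / (a ^ i m₁ ^ k₁ ⋯ mₙ ^ kₙ b ^ k (b - a))` over `a ≤ m₁ ≤ ⋯ ≤ mₙ ≤ b` with `a < b`. -/
noncomputable def gapSum (i : ℕ) (ks : List ℕ) (k : ℕ) : ℝ≥0∞ :=
  ∑' a, ∑' b, recip a ^ i * chainSum ks a b * recip b ^ k * recipGap a b

/-! ### Chains with fixed end points -/

lemma chainSum_of_lt (ks : List ℕ) {a b : ℕ+} (h : b < a) : chainSum ks a b = 0 := by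
  induction ks generalizing a with
  | nil => simp [chainSum, h]
  | cons k ks ih =>
    simp only [chainSum, ENNReal.tsum_eq_zero]
    intro m
    split_ifs with hm
    · rw [ih (h.trans_le hm), mul_zero]
    · rfl

lemma chainSum_self (ks : List ℕ) (a : ℕ+) : chainSum ks a a = recip a ^ ks.sum := by
  induction ks with
  | nil => simp [chainSum]
  | cons k ks ih =>
    rw [chainSum, tsum_eq_single a]
    · simp [ih, pow_add]
    · intro m hm
      split_ifs with h
      · rw [chainSum_of_lt ks (lt_of_le_of_ne h hm.symm), mul_zero]
      · rfl

lemma chainSum_concat (ks : List ℕ) (l : ℕ) (a b : ℕ+) :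
    chainSum (ks ++ [l]) a b = ∑' c, if c ≤ b then chainSum ks a c * recip c ^ l else 0 := by
  induction ks generalizing a with
  | nil =>
    simp only [List.nil_append, chainSum]
    refine tsum_congr fun c => ?_
    split_ifs <;> simp
  | cons k ks ih =>
    simp only [List.cons_append, chainSum, ih]
    calc _ = ∑' m, ∑' c, if a ≤ m ∧ c ≤ b then
            recip m ^ k * chainSum ks m c * recip c ^ l else 0 := by
          refine tsum_congr fun m => ?_
          split_ifs with h
          · rw [← ENNReal.tsum_mul_left]
            refine tsum_congr fun c => ?_
            by_cases hc : c ≤ b <;> simp [h, hc, mul_assoc]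
          · simp [h]
      _ = _ := by
          rw [ENNReal.tsum_comm]
          refine tsum_congr fun c => ?_
          split_ifs with h
          · rw [← ENNReal.tsum_mul_right]
            refine tsum_congr fun m => ?_
            by_cases hm : a ≤ m <;> simp [h, hm]
          · simp [h]

lemma starSum_concat (ks : List ℕ) (k : ℕ) (a : ℕ+) :
    starSum (ks ++ [k]) a = ∑' b, chainSum ks a b * recip b ^ k := by
  induction ks generalizing a with
  | nil =>
    simp only [List.nil_append, starSum, chainSum]
    refine tsum_congr fun c => ?_
    split_ifs <;> simp
  | cons l ks ih =>
    simp only [List.cons_append, starSum, chainSum, ih]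
    simp_rw [← ENNReal.tsum_mul_right]
    rw [ENNReal.tsum_comm]
    refine tsum_congr fun m => ?_
    split_ifs with h
    · simp [← ENNReal.tsum_mul_left, mul_assoc]
    · simp

/-! ### Shifting an exponent by partial fractions -/

lemma recip_mul_recipGap_add {a b : ℕ+} (h : a < b) :
    recip b * recipGap a b + recip a * recip b = recip a * recipGap a b := by
  obtain ⟨d, rfl⟩ : ∃ d, b = a + d := ⟨b - a, (PNat.add_sub_of_lt h).symm⟩
  have hnn : ((a + d : NNReal))⁻¹ * (d : NNReal)⁻¹ + (a : NNReal)⁻¹ * ((a + d : NNReal))⁻¹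
      = (a : NNReal)⁻¹ * (d : NNReal)⁻¹ := by
    have ha : (a : NNReal) ≠ 0 := by simp
    have hd : (d : NNReal) ≠ 0 := by simp
    have had : (a : NNReal) + d ≠ 0 := by positivity
    field_simp
  have key (n : ℕ+) : recip n = (((n : NNReal)⁻¹ : NNReal) : ℝ≥0∞) := by
    rw [ENNReal.coe_inv (by simp)]; simp [recip]
  have key2 : recipGap a (a + d) = recip d := by
    simp [recipGap, recip, PNat.lt_add_right]
  rw [key2, key, key, key]
  rw [← ENNReal.coe_mul, ← ENNReal.coe_mul, ← ENNReal.coe_mul, ← ENNReal.coe_add, PNat.add_coe,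
    Nat.cast_add, hnn]

lemma starSum_cons_concat (i : ℕ) (ks : List ℕ) (k : ℕ) :
    starSum ([i] ++ ks ++ [k]) 1
      = (∑' a, ∑' b, if a < b then recip a ^ i * chainSum ks a b * recip b ^ k else 0)
        + ezeta (i + ks.sum + k) := by
  rw [ezeta, ← ENNReal.tsum_add]
  simp only [List.cons_append, List.nil_append, starSum, one_le, if_true]
  refine tsum_congr fun a => ?_
  have : recip a ^ (i + ks.sum + k)
      = ∑' b, if b = a then recip a ^ i * chainSum ks a b * recip b ^ k else 0 := by
    rw [tsum_ite_eq, chainSum_self, pow_add, pow_add]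
  rw [this, ← ENNReal.tsum_add, starSum_concat, ← ENNReal.tsum_mul_left]
  refine tsum_congr fun b => ?_
  rcases lt_trichotomy a b with h | rfl | h
  · simp [h, h.ne', mul_assoc]
  · simp [mul_assoc]
  · simp [h.ne, h.not_gt, chainSum_of_lt ks h]

lemma gapSum_add_starSum (i : ℕ) (ks : List ℕ) (k : ℕ) :
    gapSum i ks (k + 1) + starSum ([i + 1] ++ ks ++ [k + 1]) 1
      = gapSum (i + 1) ks k + ezeta (i + ks.sum + k + 2) := by
  rw [starSum_cons_concat, ← add_assoc]
  congr 1
  · simp only [gapSum, ← ENNReal.tsum_add]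
    refine tsum_congr fun a => tsum_congr fun b => ?_
    split_ifs with h
    · calc _ = recip a ^ i * chainSum ks a b * recip b ^ k *
            (recip b * recipGap a b + recip a * recip b) := by ring
        _ = _ := by rw [recip_mul_recipGap_add h]; ring
    · simp [recipGap, h]
  · congr 1; ring

/-! ### Telescoping and rotation of the index -/

lemma hasSum_inv_sub_inv_add (x a : ℕ) (hx : 0 < x) :
    HasSum (fun n : ℕ => ((x + n : ℝ))⁻¹ - ((x + n + a : ℝ))⁻¹)
      (∑ j ∈ Finset.range a, ((x + j : ℝ))⁻¹) := by
  induction a with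
  | zero => simp
  | succ a ih =>
    have step : HasSum (fun n : ℕ => ((x + n + a : ℝ))⁻¹ - ((x + n + a + 1 : ℝ))⁻¹)
        ((x + a : ℝ)⁻¹) := by
      rw [hasSum_iff_tendsto_nat_of_nonneg]
      · have h (N : ℕ) : ∑ n ∈ Finset.range N,
            (((x + n + a : ℝ))⁻¹ - ((x + n + a + 1 : ℝ))⁻¹) =
              (x + a : ℝ)⁻¹ - ((N : ℝ) + (x + a))⁻¹ := by
          have := Finset.sum_range_sub' (fun n : ℕ => ((x + n + a : ℝ))⁻¹) N
          simp only [Nat.cast_add, Nat.cast_one, Nat.cast_zero, add_zero] at this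
          rw [show (N : ℝ) + (x + a) = x + N + a by ring, ← this]
          refine Finset.sum_congr rfl fun n _ => ?_
          congr 2; ring
        simp_rw [h]
        have := (Filter.tendsto_atTop_add_const_right Filter.atTop ((x : ℝ) + a)
          tendsto_natCast_atTop_atTop).inv_tendsto_atTop
        simpa using this.const_sub ((x + a : ℝ)⁻¹)
      · intro n
        exact sub_nonneg.2 (inv_anti₀ (by positivity) (by linarith))
    rw [Finset.sum_range_succ]
    refine (ih.add step).congr_fun ?_
    intro n
    push_cast
    ring_nf

lemma tsum_inv_mul_inv_add (x : ℕ) (hx : 0 < x) (a : ℕ+) :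
    ∑' n : ℕ, ((x + n + (a : ℕ) : ℕ) : ℝ≥0∞)⁻¹ * ((x + n : ℕ) : ℝ≥0∞)⁻¹
      = recip a * ∑ j ∈ Finset.range a, ((x + j : ℕ) : ℝ≥0∞)⁻¹ := by
  have ha : (0 : ℝ) < (a : ℕ) := by exact_mod_cast a.pos
  have key (n : ℕ) (hn : 0 < n) : ((n : ℕ) : ℝ≥0∞)⁻¹ = ENNReal.ofReal ((n : ℝ)⁻¹) := by
    rw [ENNReal.ofReal_inv_of_pos (by exact_mod_cast hn), ENNReal.ofReal_natCast]
  have h := (hasSum_inv_sub_inv_add x a hx).mul_left ((a : ℕ) : ℝ)⁻¹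
  have hterm (n : ℕ) : ((x + n + (a : ℕ) : ℕ) : ℝ≥0∞)⁻¹ * ((x + n : ℕ) : ℝ≥0∞)⁻¹
      = ENNReal.ofReal (((a : ℕ) : ℝ)⁻¹ * (((x + n : ℝ))⁻¹ - ((x + n + (a : ℕ) : ℝ))⁻¹)) := by
    have h1 : (0 : ℝ) < x + n := by exact_mod_cast Nat.add_pos_left hx n
    rw [key _ (by omega), key _ (by omega), ← ENNReal.ofReal_mul (by positivity)]
    congr 1
    push_cast
    field_simp
    ring
  simp_rw [hterm]
  rw [← ENNReal.ofReal_tsum_of_nonneg _ h.summable, h.tsum_eq,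
    ENNReal.ofReal_mul (by positivity), ENNReal.ofReal_sum_of_nonneg (by intros; positivity)]
  · rw [recip, key _ a.pos]
    congr 1
    refine Finset.sum_congr rfl fun j _ => ?_
    rw [key _ (by omega)]
    push_cast
    rfl
  · intro n
    have h1 : (0 : ℝ) < x + n := by exact_mod_cast Nat.add_pos_left hx n
    have : ((x + n + (a : ℕ) : ℝ))⁻¹ ≤ ((x + n : ℝ))⁻¹ :=
      inv_anti₀ h1 (by linarith)
    exact mul_nonneg (by positivity) (sub_nonneg.2 this)

lemma tsum_ite_pnat_le (M : ℕ+) (f : ℕ → ℝ≥0∞) :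
    ∑' b : ℕ+, (if M ≤ b then f ((b : ℕ) - (M : ℕ)) else 0) = ∑' n, f n := by
  let g : ℕ → ℕ+ := fun n => ⟨(M : ℕ) + n, Nat.add_pos_left M.pos n⟩
  have hinj : Function.Injective g := by
    intro m n h
    exact Nat.add_left_cancel (congrArg PNat.val h)
  rw [← hinj.tsum_eq]
  · refine tsum_congr fun n => ?_
    rw [if_pos (by rw [← PNat.coe_le_coe]; simp [g])]
    simp [g]
  · intro b hb
    have hMb : (M : ℕ) ≤ b := by
      by_contra h
      exact hb (if_neg h)
    exact ⟨b - M, PNat.eq (Nat.add_sub_cancel' hMb)⟩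

lemma tsum_ite_pnat_ge (a : ℕ+) (f : ℕ → ℝ≥0∞) :
    ∑' p : ℕ+, (if p ≤ a then f ((a : ℕ) - (p : ℕ)) else 0) = ∑ j ∈ Finset.range a, f j := by
  rw [tsum_eq_sum (s := Finset.Icc 1 a)]
  · refine Finset.sum_bij' (fun p _ => (a : ℕ) - (p : ℕ))
      (fun j _ => Nat.toPNat' ((a : ℕ) - j)) ?_ ?_ ?_ ?_ ?_
    · intro p _
      have := p.pos
      have := a.pos
      rw [Finset.mem_range]; omega
    · intro j hj
      rw [Finset.mem_range] at hj
      rw [Finset.mem_Icc, ← PNat.coe_le_coe, ← PNat.coe_le_coe, Nat.toPNat'_coe,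
        if_pos (by omega)]
      simp; omega
    · intro p hp
      rw [Finset.mem_Icc, ← PNat.coe_le_coe, ← PNat.coe_le_coe] at hp
      have := p.pos
      apply PNat.eq
      rw [Nat.toPNat'_coe, if_pos (by omega)]
      omega
    · intro j hj
      rw [Finset.mem_range] at hj
      rw [Nat.toPNat'_coe, if_pos (by omega)]
      omega
    · intro p hp
      rw [if_pos (Finset.mem_Icc.1 hp).2]
  · intro p hp
    rw [if_neg]
    simpa using hp

/-- Since 1/(b(b-a)) = (1/a)(1/(b-a) - 1/b), the sum over b ≥ c telescopes to the a terms 1/(c-p), 1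
≤ p ≤ a. -/
lemma tsum_recip_mul_recipGap {a c : ℕ+} (h : a ≤ c) :
    ∑' b, (if c ≤ b then recip b * recipGap a b else 0)
      = recip a * (∑' p, if p ≤ a then recipGap p c else 0)
        + if c = a then recip a ^ 2 else 0 := by
  have hac : (a : ℕ) ≤ c := h
  have hR : ∑' p, (if p ≤ a then recipGap p c else 0)
      = ∑ j ∈ Finset.range a,
        if (c : ℕ) - a + j = 0 then 0 else (((c : ℕ) - a + j : ℕ) : ℝ≥0∞)⁻¹ := by
    rw [← tsum_ite_pnat_ge]
    refine tsum_congr fun p => ?_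
    split_ifs with hp
    · have hp' : (p : ℕ) ≤ a := hp
      rw [recipGap, if_neg]
      rw [← PNat.coe_lt_coe]; omega
    · have hp' : (p : ℕ) ≤ a := hp
      rw [recipGap, if_pos (by rw [← PNat.coe_lt_coe]; omega)]
      congr 2; omega
    · rfl
  rw [hR]
  rcases h.lt_or_eq with hlt | rfl
  · have hlt' : (a : ℕ) < c := hlt
    rw [if_neg hlt.ne', add_zero]
    have := tsum_inv_mul_inv_add ((c : ℕ) - a) (by omega) a
    rw [Finset.sum_congr rfl fun j _ => if_neg (by omega), ← this, ← tsum_ite_pnat_le c]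
    refine tsum_congr fun b => ?_
    split_ifs with hb
    · have hb' : (c : ℕ) ≤ b := hb
      rw [recip, recipGap, if_pos (hlt.trans_le hb)]
      congr 3 <;> omega
    · rfl
  · rw [if_pos rfl]
    -- For c = a the terms b = a and p = a both vanish. The sum over b thus yields the harmonic
    -- number H_a and the sum over p only H_{a-1}; the missing 1/a is the correction.
    have := tsum_inv_mul_inv_add 1 one_pos a
    have hsum : ∑ j ∈ Finset.range a, ((1 + j : ℕ) : ℝ≥0∞)⁻¹
        = (∑ j ∈ Finset.range a,
          if (a : ℕ) - a + j = 0 then 0 else (((a : ℕ) - a + j : ℕ) : ℝ≥0∞)⁻¹) + recip a := by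
      have hs := Finset.sum_range_succ' (fun j : ℕ => if j = 0 then 0 else ((j : ℕ) : ℝ≥0∞)⁻¹) a
      rw [Finset.sum_range_succ] at hs
      simp only [Nat.add_eq_zero_iff, one_ne_zero, and_false, if_false, if_true, add_zero,
        PNat.ne_zero] at hs
      simp only [tsub_self, zero_add, recip, hs, add_comm 1]
    rw [sq, ← mul_add, ← hsum, ← this, ← tsum_ite_pnat_le (a + 1)]
    refine tsum_congr fun b => ?_
    by_cases hb : a < b
    · have hb' : (a : ℕ) < b := hb
      rw [if_pos hb.le, if_pos (PNat.add_one_le_iff.2 hb), recip, recipGap, if_pos hb]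
      congr 3 <;> simp <;> omega
    · simp [recipGap, hb]

lemma gapSum_concat_one (k : ℕ) (ks : List ℕ) (l : ℕ) :
    gapSum k (ks ++ [l]) 1 = gapSum 0 ((k + 1) :: ks) l + ezeta (k + ks.sum + l + 2) := by
  calc gapSum k (ks ++ [l]) 1
      = ∑' a, ∑' c, recip a ^ k * chainSum ks a c * recip c ^ l *
          ∑' b, (if c ≤ b then recip b * recipGap a b else 0) := by
        simp only [gapSum, chainSum_concat, ← ENNReal.tsum_mul_left, ← ENNReal.tsum_mul_right]
        refine tsum_congr fun a => ?_
        rw [ENNReal.tsum_comm]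
        refine tsum_congr fun c => tsum_congr fun b => ?_
        split_ifs <;> ring
    _ = ∑' a, ∑' c, ((∑' p, if p ≤ a then
            recip a ^ (k + 1) * chainSum ks a c * recip c ^ l * recipGap p c else 0)
          + if c = a then recip a ^ (k + ks.sum + l + 2) else 0) := by
        refine tsum_congr fun a => tsum_congr fun c => ?_
        by_cases hac : a ≤ c
        · rw [tsum_recip_mul_recipGap hac, mul_add]
          congr 1
          · rw [← mul_assoc, ← ENNReal.tsum_mul_left]
            refine tsum_congr fun p => ?_
            split_ifs <;> ring
          · split_ifs with h
            · subst h
              rw [chainSum_self]; ring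
            · simp
        · have := chainSum_of_lt ks (not_le.1 hac)
          have hne : c ≠ a := fun h => hac h.ge
          simp [this, hne]
    _ = _ := by
        simp only [ENNReal.tsum_add, tsum_ite_eq, ezeta]
        congr 1
        simp only [gapSum, chainSum, ← ENNReal.tsum_mul_left, ← ENNReal.tsum_mul_right]
        calc _ = ∑' a, ∑' p, ∑' c, _ := tsum_congr fun a => ENNReal.tsum_comm
          _ = ∑' p, ∑' a, ∑' c, _ := ENNReal.tsum_comm
          _ = ∑' p, ∑' c, ∑' a, _ := tsum_congr fun p => ENNReal.tsum_comm
          _ = _ := by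
            refine tsum_congr fun p => tsum_congr fun c => tsum_congr fun a => ?_
            split_ifs <;> ring

/-- The rotation with no interior variable: a itself takes the role of c, so the correction occurs
for every a. -/
lemma gapSum_nil_one (k : ℕ) : gapSum k [] 1 = gapSum 0 [] (k + 1) + ezeta (k + 2) := by
  calc gapSum k [] 1
      = ∑' a, recip a ^ k * ∑' b, (if a ≤ b then recip b * recipGap a b else 0) := by
        simp only [gapSum, chainSum, ← ENNReal.tsum_mul_left]
        refine tsum_congr fun a => tsum_congr fun b => ?_
        split_ifs <;> ring
    _ = ∑' a, ((∑' p, if p ≤ a then recip a ^ (k + 1) * recipGap p a else 0)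
          + recip a ^ (k + 2)) := by
        refine tsum_congr fun a => ?_
        rw [tsum_recip_mul_recipGap le_rfl, if_pos rfl, mul_add, ← mul_assoc,
          ← ENNReal.tsum_mul_left]
        congr 1
        · refine tsum_congr fun p => ?_
          split_ifs <;> ring
        · ring
    _ = _ := by
        rw [ENNReal.tsum_add, ENNReal.tsum_comm, ezeta]
        congr 1
        simp only [gapSum, chainSum]
        refine tsum_congr fun p => tsum_congr fun a => ?_
        split_ifs <;> ring

/-! ### Finiteness -/

lemma recip_le_one (a : ℕ+) : recip a ≤ 1 := by
  rw [recip, ENNReal.inv_le_one]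
  exact_mod_cast a.pos

lemma recip_anti {a b : ℕ+} (h : a ≤ b) : recip b ≤ recip a := by
  rw [recip, recip, ENNReal.inv_le_inv]
  exact_mod_cast h

lemma tsum_recip_rpow_ne_top {t : ℝ} (ht : 1 < t) : ∑' a, recip a ^ t ≠ ∞ := by
  have h : Summable fun a : ℕ+ => ((a : ℕ) : ℝ) ^ (-t) :=
    (Real.summable_nat_rpow.2 (by linarith)).comp_injective PNat.coe_injective
  have hterm (a : ℕ+) : recip a ^ t = ENNReal.ofReal (((a : ℕ) : ℝ) ^ (-t)) := by
    have : (0 : ℝ) < (a : ℕ) := by exact_mod_cast a.pos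
    rw [← ENNReal.ofReal_rpow_of_pos this, ENNReal.ofReal_natCast, recip, ENNReal.inv_rpow,
      ENNReal.rpow_neg]
  simp_rw [hterm]
  exact h.tsum_ofReal_ne_top

lemma ezeta_ne_top {n : ℕ} (hn : 2 ≤ n) : ezeta n ≠ ∞ := by
  have h := tsum_recip_rpow_ne_top (t := n) (by exact_mod_cast hn)
  simpa only [ENNReal.rpow_natCast, ezeta] using h

lemma chainSum_le {ks : List ℕ} (h : ∀ k ∈ ks, 2 ≤ k) (a b : ℕ+) :
    chainSum ks a b ≤ ezeta 2 ^ ks.length := by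
  induction ks generalizing a with
  | nil => rw [chainSum]; split_ifs <;> simp
  | cons k ks ih =>
    rw [chainSum, List.length_cons, pow_succ', ezeta, ← ENNReal.tsum_mul_right]
    refine ENNReal.tsum_le_tsum fun m => ?_
    split_ifs
    · exact mul_le_mul' (pow_le_pow_right_of_le_one' (recip_le_one m) (h k (by simp)))
        (ih (fun j hj => h j (by simp [hj])) m)
    · exact zero_le

lemma tsum_recip_sq_mul_recipGap_ne_top :
    ∑' a, ∑' b, recip b ^ 2 * recipGap a b ≠ ∞ := by
  set C := ∑' a, recip a ^ (3 / 2 : ℝ) with hC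
  have hCtop : C ≠ ∞ := tsum_recip_rpow_ne_top (by norm_num)
  refine ne_top_of_le_ne_top (ENNReal.mul_ne_top hCtop hCtop) ?_
  rw [hC, ← ENNReal.tsum_mul_right]
  refine ENNReal.tsum_le_tsum fun a => ?_
  rw [← (add_right_injective a).tsum_eq, ← ENNReal.tsum_mul_left]
  · refine ENNReal.tsum_le_tsum fun d => ?_
    have hgap : recipGap a (a + d) = recip d := by simp [recipGap, recip, PNat.lt_add_right]
    rw [hgap]
    -- Splitting 2 = 3/2 + 1/2 leaves both a and d with exponent 3/2 > 1.
    calc recip (a + d) ^ 2 * recip d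
        = recip (a + d) ^ (3 / 2 : ℝ) * recip (a + d) ^ (1 / 2 : ℝ) * recip d := by
          rw [← ENNReal.rpow_add_of_nonneg _ _ (by norm_num) (by norm_num),
            ← ENNReal.rpow_natCast]
          norm_num
      _ ≤ recip a ^ (3 / 2 : ℝ) * recip d ^ (1 / 2 : ℝ) * recip d := by
          gcongr
          · exact recip_anti (PNat.lt_add_right a d).le
          · exact recip_anti (PNat.lt_add_left d a).le
      _ = recip a ^ (3 / 2 : ℝ) * recip d ^ (3 / 2 : ℝ) := by
          rw [mul_assoc]
          nth_rewrite 2 [← ENNReal.rpow_one (recip d)]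
          rw [← ENNReal.rpow_add_of_nonneg _ _ (by norm_num) (by norm_num)]
          norm_num
  · intro b hb
    have hab : a < b := by
      by_contra h
      exact hb (by simp [recipGap, h])
    exact ⟨b - a, PNat.add_sub_of_lt hab⟩

lemma gapSum_ne_top {ks : List ℕ} (h : ∀ k ∈ ks, 2 ≤ k) {k : ℕ} (hk : 2 ≤ k) :
    gapSum 0 ks k ≠ ∞ := by
  refine ne_top_of_le_ne_top (ENNReal.mul_ne_top
    (ENNReal.pow_ne_top (n := ks.length) (ezeta_ne_top le_rfl))
    tsum_recip_sq_mul_recipGap_ne_top) ?_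
  simp only [gapSum, ← ENNReal.tsum_mul_left]
  refine ENNReal.tsum_le_tsum fun a => ENNReal.tsum_le_tsum fun b => ?_
  rw [pow_zero, one_mul, mul_assoc]
  exact mul_le_mul' (chainSum_le h a b)
    (mul_le_mul_left (pow_le_pow_right_of_le_one' (recip_le_one b) hk) _)

/-! ### Comparison with the real series -/

/-- The lower bound a is what lets the induction peel off the smallest variable. -/
lemma tsum_monotone_eq_starSum (k : List ℕ) (a : ℕ+) :
    ∑' m : Fin k.length → ℕ+, (if Monotone m ∧ ∀ j, a ≤ m j then
      ∏ j, recip (m j) ^ k.get j else 0) = starSum k a := by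
  induction k generalizing a with
  | nil =>
    have : Unique (Fin ([] : List ℕ).length → ℕ+) := @Pi.uniqueOfIsEmpty _ Fin.isEmpty _
    rw [starSum, tsum_eq_single default fun m hm => (hm (Subsingleton.elim _ _)).elim, if_pos]
    · rfl
    · exact ⟨fun i => i.elim0, fun i => i.elim0⟩
  | cons l k ih =>
    refine ((Fin.consEquiv fun _ : Fin (k.length + 1) => ℕ+).tsum_eq _).symm.trans ?_
    rw [ENNReal.tsum_prod', starSum]
    refine tsum_congr fun x => ?_
    have hmono (m : Fin k.length → ℕ+) :
        (Monotone (Fin.cons x m : Fin (k.length + 1) → ℕ+) ∧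
          ∀ j, a ≤ (Fin.cons x m : Fin (k.length + 1) → ℕ+) j) ↔
        a ≤ x ∧ Monotone m ∧ ∀ j, x ≤ m j := by
      constructor
      · rintro ⟨h1, h2⟩
        refine ⟨h2 0, fun i j hij => ?_, fun j => ?_⟩
        · simpa using h1 (Fin.succ_le_succ_iff.2 hij)
        · simpa using h1 (Fin.zero_le j.succ)
      · rintro ⟨h1, h2, h3⟩
        refine ⟨fun i j hij => ?_, fun j => ?_⟩
        · induction i using Fin.cases with
          | zero => induction j using Fin.cases with
            | zero => exact le_rfl
            | succ j => exact h3 j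
          | succ i => induction j using Fin.cases with
            | zero => exact absurd hij (by simp)
            | succ j => exact h2 (Fin.succ_le_succ_iff.1 hij)
        · induction j using Fin.cases with
          | zero => exact h1
          | succ j => exact h1.trans (h3 j)
    have hprod (m : Fin k.length → ℕ+) :
        ∏ j : Fin (k.length + 1), recip ((Fin.cons x m : Fin (k.length + 1) → ℕ+) j)
          ^ (l :: k).get j = recip x ^ l * ∏ j, recip (m j) ^ k.get j := by
      rw [Fin.prod_univ_succ]
      rfl
    rw [← ih x]
    split_ifs with hax
    · rw [← ENNReal.tsum_mul_left]
      refine tsum_congr fun m => ?_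
      refine (if_congr (hmono m) (hprod m) rfl).trans ?_
      by_cases h : Monotone m ∧ ∀ j, x ≤ m j <;> simp [h, hax]
    · refine ENNReal.tsum_eq_zero.2 fun m => ?_
      exact if_neg fun h => hax ((hmono m).1 h).1

lemma mzsvTerm_nonneg (k : List ℕ) (m : {m : Fin k.length → ℕ+ // Monotone m}) :
    0 ≤ mzsvTerm k m := by
  unfold mzsvTerm
  positivity

lemma ofReal_mzsvTerm (k : List ℕ) (m : {m : Fin k.length → ℕ+ // Monotone m}) :
    ENNReal.ofReal (mzsvTerm k m) = ∏ j, recip (m.1 j) ^ k.get j := by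
  rw [mzsvTerm, one_div, ← Finset.prod_inv_distrib,
    ENNReal.ofReal_prod_of_nonneg (by intros; positivity)]
  refine Finset.prod_congr rfl fun j _ => ?_
  have : (0 : ℝ) < ((m.1 j : ℕ) : ℝ) := by exact_mod_cast (m.1 j).pos
  rw [← inv_pow, ENNReal.ofReal_pow (by positivity), ENNReal.ofReal_inv_of_pos this,
    ENNReal.ofReal_natCast, recip]

lemma tsum_ofReal_mzsvTerm (k : List ℕ) :
    ∑' m, ENNReal.ofReal (mzsvTerm k m) = starSum k 1 := by
  rw [← tsum_monotone_eq_starSum]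
  simp only [ofReal_mzsvTerm, one_le, implies_true, and_true]
  refine (tsum_subtype {m : Fin k.length → ℕ+ | Monotone m}
    fun m => ∏ j, recip (m j) ^ k.get j).trans ?_
  refine tsum_congr fun m => ?_
  simp [Set.indicator_apply]

lemma summable_mzsvTerm {k : List ℕ} (h : starSum k 1 ≠ ∞) : Summable (mzsvTerm k) := by
  rw [← tsum_ofReal_mzsvTerm] at h
  refine (ENNReal.summable_toReal h).congr fun m => ?_
  exact ENNReal.toReal_ofReal (mzsvTerm_nonneg k m)

lemma zetaStar_eq_toReal (k : List ℕ) : zetaStar k = (starSum k 1).toReal := by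
  rw [← tsum_ofReal_mzsvTerm, ENNReal.tsum_toReal_eq fun _ => ENNReal.ofReal_ne_top, zetaStar]
  exact tsum_congr fun m => (ENNReal.toReal_ofReal (mzsvTerm_nonneg k m)).symm

lemma riemannZeta_eq_ezeta {n : ℕ} (hn : 2 ≤ n) :
    riemannZeta n = (((ezeta n).toReal : ℝ) : ℂ) := by
  have hfin (a : ℕ+) : recip a ^ n ≠ ∞ :=
    ENNReal.pow_ne_top (ne_top_of_le_ne_top ENNReal.one_ne_top (recip_le_one a))
  rw [zeta_nat_eq_tsum_of_gt_one hn, ezeta, ENNReal.tsum_toReal_eq hfin, Complex.ofReal_tsum,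
    ← PNat.coe_injective.tsum_eq]
  · refine tsum_congr fun a => ?_
    simp [recip]
  · intro m hm
    have : m ≠ 0 := by
      rintro rfl
      exact hm (by simp [show n ≠ 0 by omega])
    exact ⟨⟨m, Nat.pos_of_ne_zero this⟩, rfl⟩

/-! ### The cycle of rotations -/

/-- One shift reduces the final 2 to 1, then a rotation; each move contributes one zeta value. -/
lemma gapSum_rotate_two (ks : List ℕ) (l w : ℕ) (hw : ks.sum + l + 3 = w) :
    gapSum 0 (ks ++ [l]) 2 + starSum ([1] ++ (ks ++ [l]) ++ [2]) 1
      = gapSum 0 (2 :: ks) l + 2 * ezeta w := by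
  subst hw
  have h1 : 0 + (ks ++ [l]).sum + 1 + 2 = ks.sum + l + 3 := by simp
  have h2 : 1 + ks.sum + l + 2 = ks.sum + l + 3 := by ring
  have h := gapSum_add_starSum 0 (ks ++ [l]) 1
  rw [h1, gapSum_concat_one, h2, add_assoc] at h
  rw [two_mul]
  exact h

/-- The gap sum of the cyclic rotation `(2, …, 2, 3, 2, …, 2)` of the index `(3, 2, …, 2)` with
`i` twos before `3` and `r - i` twos after it. -/
noncomputable def rotatedGapSum (r i : ℕ) : ℝ≥0∞ :=
  if i < r then gapSum 0 (List.replicate i 2 ++ [3] ++ List.replicate (r - i - 1) 2) 2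
  else gapSum 0 (List.replicate i 2) 3

lemma rotatedGapSum_ne_top (r i : ℕ) : rotatedGapSum r i ≠ ∞ := by
  unfold rotatedGapSum
  split_ifs
  · refine gapSum_ne_top (fun k hk => ?_) le_rfl
    simp only [List.mem_append, List.mem_replicate, List.mem_singleton] at hk
    omega
  · refine gapSum_ne_top (fun k hk => ?_) (by norm_num)
    exact (List.eq_of_mem_replicate hk).ge

lemma rotatedGapSum_add {r i : ℕ} (hi : i < r) :
    rotatedGapSum r i + starSum (indexOneThree i (r - i)) 1
      = rotatedGapSum r (i + 1) + 2 * ezeta (2 * r + 4) := by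
  obtain ⟨v, rfl⟩ : ∃ v, r = i + 1 + v := ⟨r - i - 1, by omega⟩
  have h1 : i + 1 + v - i = v + 1 := by omega
  have hidx : indexOneThree i (v + 1)
      = [1] ++ (List.replicate i 2 ++ [3] ++ List.replicate v 2) ++ [2] := by
    simp [indexOneThree, List.replicate_succ']
  rw [rotatedGapSum, rotatedGapSum, if_pos hi, h1, hidx, Nat.add_sub_cancel]
  rcases v with _ | v
  · rw [if_neg (by omega), List.replicate_zero, List.append_nil,
      gapSum_rotate_two _ _ (2 * (i + 1 + 0) + 4) (by simp; ring), List.replicate_succ]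
  · rw [if_pos (by omega), List.replicate_succ', ← List.append_assoc,
      gapSum_rotate_two _ _ (2 * (i + 1 + (v + 1)) + 4) (by simp; ring), List.replicate_succ]
    congr 3
    simp

/-- Closes the cycle: the final 3 needs two shifts before the rotation, hence two star values and
three zeta values. -/
lemma rotatedGapSum_self_add (r : ℕ) :
    rotatedGapSum r r + starSum (indexOneThree r 0) 1 + starSum (indexTwos (r + 2)) 1
      = rotatedGapSum r 0 + 3 * ezeta (2 * r + 4) := by
  have h1 := gapSum_add_starSum 0 (List.replicate r 2) 2
  have h2 := gapSum_add_starSum 1 (List.replicate r 2) 1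
  have h3 : gapSum 2 (List.replicate r 2) 1 = rotatedGapSum r 0 + ezeta (2 * r + 4) := by
    rcases r with _ | r
    · simpa [rotatedGapSum] using gapSum_nil_one 2
    · rw [List.replicate_succ', gapSum_concat_one]
      have hw : 2 + (List.replicate r 2).sum + 2 + 2 = 2 * (r + 1) + 4 := by simp; ring
      rw [hw]
      simp [rotatedGapSum]
  have e1 : indexOneThree r 0 = [0 + 1] ++ List.replicate r 2 ++ [2 + 1] := by
    simp [indexOneThree]
  have e2 : indexTwos (r + 2) = [1 + 1] ++ List.replicate r 2 ++ [1 + 1] := by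
    rw [indexTwos, List.replicate_succ, List.replicate_succ']; rfl
  have w1 : 0 + (List.replicate r 2).sum + 2 + 2 = 2 * r + 4 := by simp; ring
  have w2 : 1 + (List.replicate r 2).sum + 1 + 2 = 2 * r + 4 := by simp; ring
  rw [w1] at h1
  rw [w2, h3] at h2
  rw [e1, e2, rotatedGapSum, if_neg (lt_irrefl r), h1, add_right_comm, h2]
  ring

lemma starSum_cyclic (r : ℕ) :
    starSum (indexTwos (r + 2)) 1
        + ∑ i ∈ Finset.range (r + 1), starSum (indexOneThree i (r - i)) 1
      = (2 * r + 3) * ezeta (2 * r + 4) := by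
  have h := Finset.sum_congr (rfl : Finset.range r = Finset.range r)
    fun i hi => rotatedGapSum_add (Finset.mem_range.1 hi)
  rw [Finset.sum_add_distrib, Finset.sum_add_distrib, Finset.sum_const, Finset.card_range,
    nsmul_eq_mul] at h
  have h0 := rotatedGapSum_self_add r
  have hshift : ∑ i ∈ Finset.range r, rotatedGapSum r (i + 1) + rotatedGapSum r 0
      = ∑ i ∈ Finset.range r, rotatedGapSum r i + rotatedGapSum r r := by
    rw [← Finset.sum_range_succ', Finset.sum_range_succ]
  have hfin : ∑ i ∈ Finset.range r, rotatedGapSum r i + rotatedGapSum r r ≠ ∞ :=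
    ENNReal.add_ne_top.2 ⟨ENNReal.sum_ne_top.2 fun i _ => rotatedGapSum_ne_top r i,
      rotatedGapSum_ne_top r r⟩
  -- Adding the total of all gap sums to both sides is reversible in `ℝ≥0∞` only because that total
  -- is finite.
  refine (ENNReal.add_right_inj hfin).1 ?_
  rw [Finset.sum_range_succ, Nat.sub_self]
  calc _ = (∑ i ∈ Finset.range r, rotatedGapSum r i
          + ∑ i ∈ Finset.range r, starSum (indexOneThree i (r - i)) 1)
        + (rotatedGapSum r r + starSum (indexOneThree r 0) 1
          + starSum (indexTwos (r + 2)) 1) := by ring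
    _ = _ := by rw [h, h0, ← hshift]; ring

theorem mainTheorem6 (s : ℕ) (hs : 1 ≤ s) :
    Summable (mzsvTerm (indexTwos s)) ∧
    (∀ i ∈ Finset.range (s - 1), Summable (mzsvTerm (indexOneThree i (s - 2 - i)))) ∧
    (2 * (s : ℂ) - 1) * riemannZeta (2 * (s : ℂ)) =
      ((zetaStar (indexTwos s) +
        ∑ i ∈ Finset.range (s - 1), zetaStar (indexOneThree i (s - 2 - i)) : ℝ) : ℂ) := by
  have hzeta := riemannZeta_eq_ezeta (n := 2 * s) (by omega)
  push_cast at hzeta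
  rw [hzeta]
  have hfin : ezeta (2 * s) ≠ ∞ := ezeta_ne_top (by omega)
  have hsum : starSum (indexTwos s) 1
      + ∑ i ∈ Finset.range (s - 1), starSum (indexOneThree i (s - 2 - i)) 1
      = ((2 * s - 1 : ℕ) : ℝ≥0∞) * ezeta (2 * s) := by
    rcases s with _ | _ | r
    · omega
    · simp [indexTwos, starSum, ezeta]
    · have := starSum_cyclic r
      simp only [show r + 1 + 1 - 2 = r by omega,
        show r + 1 + 1 - 1 = r + 1 by omega] at *
      rw [show 2 * (r + 1 + 1) - 1 = 2 * r + 3 by omega,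
        show 2 * (r + 1 + 1) = 2 * r + 4 by ring]
      push_cast
      exact this
  have hne : starSum (indexTwos s) 1
      + ∑ i ∈ Finset.range (s - 1), starSum (indexOneThree i (s - 2 - i)) 1 ≠ ∞ := by
    rw [hsum]
    exact ENNReal.mul_ne_top (ENNReal.natCast_ne_top _) hfin
  obtain ⟨h1, h2⟩ := ENNReal.add_ne_top.1 hne
  have h3 := ENNReal.sum_ne_top.1 h2
  refine ⟨summable_mzsvTerm h1, fun i hi => summable_mzsvTerm (h3 i hi), ?_⟩
  simp_rw [zetaStar_eq_toReal]
  rw [← ENNReal.toReal_sum h3, ← ENNReal.toReal_add h1 h2, hsum, ENNReal.toReal_mul,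
    ENNReal.toReal_natCast, Complex.ofReal_mul, Complex.ofReal_natCast,
    Nat.cast_sub (by omega)]
  push_cast
  rfl
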